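/- Let $n\ge 3$ and $m\ge 1$ be integers with $2m\le n+1$, and let $\mathcal M$ be a collection of $m$ lines in $\mathbb P^n=\mathbb P^n_{\mathbb C}$ in general linear position, meaning that for every $s$ any $s$ of the lines span a linear subspace of projective dimension $\min\{2s-1,n\}$. Let $S=\mathbb C[x_0,\ldots,x_n]$, let $J\subseteq S$ be the defining ideal of $\mathcal M$ (the ideal of polynomials vanishing at all homogeneous coordinate vectors of all points of the union of the lines), and let $R=S/J$ be the coordinate ring. Then: 1. After an invertible linear change of the coordinates $x_0,\ldots,x_n$, the ideal $J$ is minimally generated by monomials of degree at most $2$; that is, it has a generating set consisting of monomials of degree at most $2$, no proper subset of which generates it. 2. $R$ is Koszul: the minimal graded free resolution of $\mathbb C\cong R/\mathfrak m_R$ over $R$ is linear, where $\mathfrak m_R$ is the ideal of $R$ generated by the elements of positive degree; that is, $\beta^R_{i,j}(\mathbb C)=0$ for all $i\ne j$. -/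

import Mathlib

open MvPolynomial
open scoped LinearAlgebra.Projectivization

/-- A line in projective `n`-space over `ℂ`: a two-dimensional subspace of `ℂ ^ (n + 1)`. -/
structure ProjLine (n : ℕ) where
  /-- the linear subspace whose one-dimensional subspaces are the points of the line -/
  space : Submodule ℂ (Fin (n + 1) → ℂ)
  finrank_eq : Module.finrank ℂ space = 2

/-- The set of points of projective space lying on the line. -/
def ProjLine.points {n : ℕ} (L : ProjLine n) : Set (ℙ ℂ (Fin (n + 1) → ℂ)) :=
  {p | p.submodule ≤ L.space}

/-- Lines are in general linear position when any `s` of them span a projective subspace of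
dimension `min (2 s - 1) n`, that is, a linear subspace of dimension `min (2 s) (n + 1)`. -/
def InGeneralLinearPosition {n m : ℕ} (L : Fin m → ProjLine n) : Prop :=
  ∀ s : Finset (Fin m),
    Module.finrank ℂ (⨆ i ∈ s, (L i).space : Submodule ℂ (Fin (n + 1) → ℂ)) =
      min (2 * s.card) (n + 1)

/-- The defining ideal of a set `X` of points of projective space: all polynomials that vanish at
every vector of homogeneous coordinates of every point of `X`. -/
noncomputable def definingIdeal {n : ℕ} (X : Set (ℙ ℂ (Fin (n + 1) → ℂ))) :
    Ideal (MvPolynomial (Fin (n + 1)) ℂ) :=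
  vanishingIdeal ℂ {v | ∃ hv : v ≠ 0, Projectivization.mk ℂ v hv ∈ X}

/-- The defining ideal of a collection of lines, that is, of the union of the lines. -/
noncomputable def linesIdeal {n m : ℕ} (L : Fin m → ProjLine n) :
    Ideal (MvPolynomial (Fin (n + 1)) ℂ) :=
  definingIdeal (⋃ i, (L i).points)

/-- The coordinate ring of a collection of lines. -/
abbrev LinesRing {n m : ℕ} (L : Fin m → ProjLine n) : Type :=
  MvPolynomial (Fin (n + 1)) ℂ ⧸ linesIdeal L

/-- The degree pieces of a quotient of the polynomial ring: the images of the spaces of forms. -/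
noncomputable def quotientGrading {n : ℕ} (J : Ideal (MvPolynomial (Fin (n + 1)) ℂ)) (i : ℕ) :
    Submodule ℂ (MvPolynomial (Fin (n + 1)) ℂ ⧸ J) :=
  (homogeneousSubmodule (Fin (n + 1)) ℂ i).map (Ideal.Quotient.mkₐ ℂ J).toLinearMap

/-- The substitution `x_i ↦ ∑ j, A i j * x_j`; for invertible `A`, a linear change of
coordinates of the polynomial ring. -/
noncomputable def linearSubst {n : ℕ} (A : Matrix (Fin (n + 1)) (Fin (n + 1)) ℂ) :
    MvPolynomial (Fin (n + 1)) ℂ →ₐ[ℂ] MvPolynomial (Fin (n + 1)) ℂ :=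
  aeval fun i => ∑ j, C (A i j) * X j

section Koszul

variable {K R M : Type} [Field K] [CommRing R] [Algebra K R]

/-- The maximal homogeneous ideal of a standard graded algebra, generated by the elements of
positive degree. -/
def positiveIdeal (𝒜 : ℕ → Submodule K R) : Ideal R :=
  Ideal.span {x | ∃ i, 0 < i ∧ x ∈ 𝒜 i}

/-- A minimal graded free resolution, by finitely generated free modules, of a module `M` with
degree pieces `ℳ` over an algebra `R` with degree pieces `𝒜`. The `i`-th module is the direct sum
of the `R(-deg i k)`, presented as `R ^ rank i` with the `k`-th basis vector in degree `deg i k`. -/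
structure MinimalGradedFreeResolution (𝒜 : ℕ → Submodule K R) [AddCommGroup M] [Module R M]
    [Module K M] (ℳ : ℕ → Submodule K M) where
  rank : ℕ → ℕ
  deg : (i : ℕ) → Fin (rank i) → ℕ
  /-- the differential from the module in position `i + 1` to the one in position `i` -/
  d : (i : ℕ) → (Fin (rank (i + 1)) → R) →ₗ[R] (Fin (rank i) → R)
  /-- the augmentation onto `M` -/
  aug : (Fin (rank 0) → R) →ₗ[R] M
  aug_surjective : Function.Surjective aug
  exact_aug : Function.Exact (d 0) aug
  exact_d : ∀ i, Function.Exact (d (i + 1)) (d i)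
  /-- the augmentation preserves degrees -/
  aug_mem : ∀ k, aug (Pi.single k 1) ∈ ℳ (deg 0 k)
  /-- the differentials preserve degrees -/
  d_mem : ∀ i l k e, deg i k + e = deg (i + 1) l → d i (Pi.single l 1) k ∈ 𝒜 e
  d_eq_zero : ∀ i l k, deg (i + 1) l < deg i k → d i (Pi.single l 1) k = 0
  /-- minimality: the differentials have entries in the maximal homogeneous ideal -/
  minimal : ∀ i l k, d i (Pi.single l 1) k ∈ positiveIdeal 𝒜

/-- The graded Betti number: how often `R(-j)` occurs in position `i`. -/
noncomputable def MinimalGradedFreeResolution.betti {𝒜 : ℕ → Submodule K R} [AddCommGroup M]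
    [Module R M] [Module K M] {ℳ : ℕ → Submodule K M}
    (F : MinimalGradedFreeResolution 𝒜 ℳ) (i j : ℕ) : ℕ :=
  Nat.card {k : Fin (F.rank i) // F.deg i k = j}

/-- The degree pieces of the residue field, the quotient by the maximal homogeneous ideal. -/
def residueGrading (𝒜 : ℕ → Submodule K R) (i : ℕ) : Submodule K (R ⧸ positiveIdeal 𝒜) :=
  (𝒜 i).map (Ideal.Quotient.mkₐ K (positiveIdeal 𝒜)).toLinearMap

/-- A standard graded algebra with degree pieces `𝒜` is Koszul when its residue field has a
linear minimal graded free resolution: the Betti numbers off the diagonal vanish. -/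
def IsKoszul (𝒜 : ℕ → Submodule K R) : Prop :=
  ∃ F : MinimalGradedFreeResolution 𝒜 (residueGrading 𝒜), ∀ i j, i ≠ j → F.betti i j = 0

end Koszul

/-! Since `2 * m ≤ n + 1`, the planes of the lines are independent, so joining their bases and
extending gives coordinates in which the lines are spanned by disjoint pairs of coordinate vectors.
A polynomial vanishes on a coordinate line exactly when each of its monomials involves a variable
outside the corresponding pair. The ideal is therefore monomial, generated by the variables in no
pair and the products of two variables from different pairs.

For Koszulness, `R` embeds in the product of the polynomial rings of the lines. Products across
different pairs vanish, so the maximal ideal is the direct sum of the ideals generated by the pairs.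
The relations on pair `i` are generated by its Koszul relation and by coefficient vectors with
entries in the ideal of the other pairs. The relations among these generators split again: the
Koszul coefficient must lie in that ideal, and the rest are relations on single pairs. So finitely
many types of summand recur, always with linear generators (`IsLineBouquet.isKoszul`), and iterating
gives a linear resolution (`isKoszul_of_split_syzygies`). -/

/-! ### Linear resolutions from recurring types of syzygies -/

section LinearResolution

open scoped Classical

variable {K R : Type} [Field K] [CommRing R] [Algebra K R]

/-- If a class of submodules of free modules contains the maximal homogeneous ideal and every
member is generated by linear vectors whose relations form a member again, then the algebra is
Koszul. -/
theorem isKoszul_of_linear_syzygies (𝒜 : ℕ → Submodule K R) (h0 : (1 : R) ∈ 𝒜 0)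
    (P : (n : ℕ) → Submodule R (Fin n → R) → Prop)
    (start : P 1 (Submodule.comap (LinearMap.proj 0) (positiveIdeal 𝒜)))
    (step : ∀ n N, P n N → ∃ (n' : ℕ) (f : (Fin n' → R) →ₗ[R] (Fin n → R)),
      (∀ l k, f (Pi.single l 1) k ∈ 𝒜 1) ∧ LinearMap.range f = N ∧ P n' (LinearMap.ker f)) :
    IsKoszul 𝒜 := by
  let T := {x : Σ n, Submodule R (Fin n → R) // P x.1 x.2}
  have step' : ∀ x : T, ∃ (n' : ℕ) (f : (Fin n' → R) →ₗ[R] (Fin x.1.1 → R)),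
      (∀ l k, f (Pi.single l 1) k ∈ 𝒜 1) ∧ LinearMap.range f = x.1.2 ∧
        P n' (LinearMap.ker f) := fun x => step _ _ x.2
  choose r f hlin hrange hker using step'
  -- Each entry is the kernel of the map chosen to cover the previous one, so exactness is the range
  -- condition on the next map.
  let seq : ℕ → T := fun i => Nat.rec ⟨⟨1, _⟩, start⟩
    (fun _ x => ⟨⟨r x, LinearMap.ker (f x)⟩, hker x⟩) i
  let F : MinimalGradedFreeResolution 𝒜 (residueGrading 𝒜) :=
    { rank := fun i => (seq i).1.1
      deg := fun i _ => i
      d := fun i => f (seq i)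
      aug := (Submodule.mkQ (positiveIdeal 𝒜)).comp (LinearMap.proj (0 : Fin 1))
      aug_surjective := by
        intro y
        obtain ⟨x, rfl⟩ := Submodule.mkQ_surjective _ y
        exact ⟨fun _ => x, rfl⟩
      exact_aug := by
        rw [LinearMap.exact_iff, hrange, LinearMap.ker_comp, Submodule.ker_mkQ]
        rfl
      exact_d := by
        intro i
        rw [LinearMap.exact_iff, hrange]
      aug_mem := by
        intro k
        refine ⟨1, h0, ?_⟩
        have hk : k = (0 : Fin 1) := Subsingleton.elim (α := Fin 1) _ _
        subst hk
        simp [Ideal.Quotient.mk_eq_mk]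
      d_mem := by
        intro i l k e he
        obtain rfl : e = 1 := by omega
        exact hlin _ _ _
      d_eq_zero := by
        intro i l k h
        omega
      minimal := fun i l k => Ideal.subset_span ⟨1, one_pos, hlin _ _ _⟩ }
  refine ⟨F, fun i j hij => ?_⟩
  have : IsEmpty {k : Fin (F.rank i) // F.deg i k = j} := ⟨fun k => hij k.2⟩
  exact Nat.card_of_isEmpty

/-- A version of `isKoszul_of_linear_syzygies` for a class of finite direct sums of submodules
`N s`, where the generators of `N s` have relations that split as such a direct sum. -/
theorem isKoszul_of_split_syzygies (𝒜 : ℕ → Submodule K R) (h0 : (1 : R) ∈ 𝒜 0)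
    {σ : Type} (rk : σ → ℕ) (N : (s : σ) → Submodule R (Fin (rk s) → R))
    (s₀ : σ) (hrk : rk s₀ = 1) (hs₀ : ∀ a, a ∈ N s₀ ↔ ∀ k, a k ∈ positiveIdeal 𝒜)
    (step : ∀ s, ∃ (γ : Type) (_ : Fintype γ) (t : γ → σ)
      (f : ((Σ c, Fin (rk (t c))) → R) →ₗ[R] (Fin (rk s) → R)),
      (∀ l k, f (Pi.single l 1) k ∈ 𝒜 1) ∧ LinearMap.range f = N s ∧
        ∀ a, f a = 0 ↔ ∀ c, (fun k => a ⟨c, k⟩) ∈ N (t c)) :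
    IsKoszul 𝒜 := by
  -- The class consists of the finite direct sums of submodules `N s`, up to an enumeration `e` of
  -- the coordinates.
  let P : (n : ℕ) → Submodule R (Fin n → R) → Prop := fun n M =>
    ∃ (β : Type) (_ : Fintype β) (st : β → σ) (e : Fin n ≃ Σ b, Fin (rk (st b))),
      ∀ a, a ∈ M ↔ ∀ b, (fun k => a (e.symm ⟨b, k⟩)) ∈ N (st b)
  refine isKoszul_of_linear_syzygies 𝒜 h0 P ?_ ?_
  · have e₀ : (Σ _ : Unit, Fin (rk s₀)) ≃ Fin 1 :=
      (Equiv.uniqueSigma fun _ : Unit => Fin (rk s₀)).trans (finCongr hrk)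
    refine ⟨Unit, inferInstance, fun _ => s₀, e₀.symm, fun a => ?_⟩
    have : Nonempty (Fin (rk s₀)) := ⟨Fin.cast hrk.symm 0⟩
    have h1 : ∀ x : Fin 1, a x = a 0 := fun x => by rw [Subsingleton.elim x 0]
    simp only [hs₀, Submodule.mem_comap, LinearMap.proj_apply, h1, forall_const]
  · rintro n M ⟨β, _, st, e, hM⟩
    choose γ hγ t f hlin hrange hker using step
    let e' : (Σ bc : (Σ b, γ (st b)), Fin (rk (t _ bc.2))) ≃ Fin _ := Fintype.equivFin _
    -- The block-diagonal sum of the given covers, one block for each summand `b`.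
    let F : (Fin _ → R) →ₗ[R] (Fin n → R) := LinearMap.pi fun i =>
      (LinearMap.proj (e i).2).comp ((f (st (e i).1)).comp
        (LinearMap.funLeft R R fun l => e' ⟨⟨(e i).1, l.1⟩, l.2⟩))
    have hF : ∀ a i, F a i =
        f (st (e i).1) (fun l => a (e' ⟨⟨(e i).1, l.1⟩, l.2⟩)) (e i).2 := fun _ _ => rfl
    have hF' : ∀ a b k, F a (e.symm ⟨b, k⟩) =
        f (st b) (fun l => a (e' ⟨⟨b, l.1⟩, l.2⟩)) k := by
      intro a b k
      rw [hF, Equiv.apply_symm_apply]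
    refine ⟨_, F, fun l k => ?_, ?_, Σ b, γ (st b), inferInstance, fun bc => t _ bc.2,
      e'.symm, fun a => ?_⟩
    · obtain ⟨⟨⟨b, c⟩, l⟩, rfl⟩ := e'.surjective l
      rw [hF]
      generalize e k = k
      obtain ⟨b', k⟩ := k
      by_cases hb : b' = b
      · subst hb
        convert hlin (st b') ⟨c, l⟩ k using 3
        rename_i x
        simp only [Pi.single_apply, e'.injective.eq_iff]
        congr 1
        rcases x with ⟨c', l'⟩
        simp only [eq_iff_iff]
        constructor
        · intro h
          cases h
          rfl
        · intro h
          cases h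
          rfl
      · have hz : (fun x : (Σ c, Fin (rk (t (st b') c))) =>
            (Pi.single (e' ⟨⟨b, c⟩, l⟩) 1 : Fin _ → R) (e' ⟨⟨b', x.1⟩, x.2⟩)) = 0 := by
          funext x
          rw [Pi.single_apply, if_neg, Pi.zero_apply]
          intro h
          rw [e'.injective.eq_iff] at h
          exact hb (congrArg (fun y => y.1.1) h)
        rw [hz, map_zero]
        exact (𝒜 1).zero_mem
    · ext a
      rw [hM]
      constructor
      · rintro ⟨c, rfl⟩ b
        rw [← hrange]
        exact ⟨_, funext fun k => (hF' c b k).symm⟩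
      · intro h
        simp only [← hrange, LinearMap.mem_range] at h
        choose c hc using h
        let g : (Σ bc : (Σ b, γ (st b)), Fin (rk (t _ bc.2))) → R :=
          fun y => c y.1.1 ⟨y.1.2, y.2⟩
        refine ⟨fun l => g (e'.symm l), ?_⟩
        funext i
        obtain ⟨⟨b, k⟩, rfl⟩ := e.symm.surjective i
        rw [hF', ← congrFun (hc b) k]
        simp only [Equiv.symm_apply_apply, g]
    · rw [LinearMap.mem_ker]
      constructor
      · rintro h ⟨b, c⟩
        refine (hker (st b) (fun l => a (e' ⟨⟨b, l.1⟩, l.2⟩))).1 ?_ c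
        funext k
        rw [← hF', h]
        rfl
      · intro h
        funext i
        obtain ⟨⟨b, k⟩, rfl⟩ := e.symm.surjective i
        rw [hF']
        exact congrFun ((hker (st b) _).2 fun c => h ⟨b, c⟩) k

end LinearResolution

/-! ### Syzygies over a bouquet of lines -/

section Bouquet

variable {K R ι : Type} [Field K] [CommRing R] [Algebra K R]

/-- The direct summands of the syzygy modules of the residue field of a bouquet of lines: the ideal
of all branches but possibly one, and the relations on the generators of one branch. -/
inductive BouquetSyzygy (ι : Type) : Type
  | outside (o : Option ι)
  | branch (i : ι)

/-- The rank of the free module containing the summand. -/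
abbrev BouquetSyzygy.rank : BouquetSyzygy ι → ℕ
  | outside _ => 1
  | branch _ => 2

/-- The ideal generated by the pairs of generators other than the one at `o`. -/
def outsideIdeal (z : ι → Fin 2 → R) (o : Option ι) : Ideal R :=
  Ideal.span (Set.range fun p : Σ _ : {j // some j ≠ o}, Fin 2 => z p.1 p.2)

/-- An algebra generated by pairs of elements `z i 0`, `z i 1` that embeds in a product of
polynomial rings in two variables, the `i`-th pair going to the variables of the `i`-th factor and
to zero in the others. -/
structure IsLineBouquet (z : ι → Fin 2 → R) (π : ι → R →ₐ[K] MvPolynomial (Fin 2) K) : Prop where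
  eq_zero : ∀ r, (∀ i, π i r = 0) → r = 0
  map_same : ∀ i k, π i (z i k) = X k
  map_ne : ∀ i j k, i ≠ j → π i (z j k) = 0
  exists_sub_mem : ∀ r, ∃ c : K, r - algebraMap K R c ∈ outsideIdeal z none

/-- The summand as a submodule of a free module. -/
def BouquetSyzygy.submodule (z : ι → Fin 2 → R) :
    (s : BouquetSyzygy ι) → Submodule R (Fin s.rank → R)
  | outside o => Submodule.comap (LinearMap.proj (0 : Fin 1)) (outsideIdeal z o)
  | branch i => LinearMap.ker (Fintype.linearCombination R (z i))

theorem BouquetSyzygy.mem_outside {z : ι → Fin 2 → R} {o : Option ι}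
    {a : Fin (outside o).rank → R} :
    a ∈ (outside o).submodule z ↔ a (0 : Fin 1) ∈ outsideIdeal z o := Iff.rfl

theorem BouquetSyzygy.mem_branch {z : ι → Fin 2 → R} {i : ι} {a : Fin (branch i).rank → R} :
    a ∈ (branch i).submodule z ↔ ∑ k : Fin 2, a k * z i k = 0 := Iff.rfl

theorem mem_outsideIdeal {z : ι → Fin 2 → R} {o : Option ι} [Fintype {j // some j ≠ o}] {r : R} :
    r ∈ outsideIdeal z o ↔
      ∃ a : {j // some j ≠ o} → Fin 2 → R, ∑ j, ∑ k, a j k * z j k = r := by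
  rw [outsideIdeal, Ideal.mem_span_range_iff_exists_fun]
  constructor
  · rintro ⟨c, rfl⟩
    exact ⟨fun j k => c ⟨j, k⟩, (Fintype.sum_sigma (fun p : Σ _ : {j // some j ≠ o}, Fin 2 =>
      c p * z p.1 p.2)).symm⟩
  · rintro ⟨a, rfl⟩
    exact ⟨fun p => a p.1 p.2, Fintype.sum_sigma (fun p : Σ _ : {j // some j ≠ o}, Fin 2 =>
      a p.1 p.2 * z p.1 p.2)⟩

namespace IsLineBouquet

variable {z : ι → Fin 2 → R} {π : ι → R →ₐ[K] MvPolynomial (Fin 2) K}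

theorem map_sum_eq (h : IsLineBouquet z π) {γ : Type} [Fintype γ] {j : γ → ι}
    (hj : Function.Injective j) (a : γ → Fin 2 → R) (c : γ) :
    π (j c) (∑ d, ∑ k, a d k * z (j d) k) = π (j c) (∑ k, a c k * z (j c) k) := by
  rw [map_sum, Finset.sum_eq_single c]
  · intro d _ hd
    simp [h.map_ne _ _ _ fun e => hd (hj e).symm]
  · simp

theorem map_sum_eq_zero (h : IsLineBouquet z π) {γ : Type} [Fintype γ] {j : γ → ι} {i : ι}
    (hi : ∀ c, i ≠ j c) (a : γ → Fin 2 → R) :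
    π i (∑ d, ∑ k, a d k * z (j d) k) = 0 := by
  simp [h.map_ne _ _ _ (hi _)]

/-- The other projections kill the pair `i`, so only `π i` can detect such a combination. -/
theorem sum_branch_eq_zero (h : IsLineBouquet z π) {i : ι} {a : Fin 2 → R}
    (ha : π i (∑ k, a k * z i k) = 0) : ∑ k, a k * z i k = 0 := by
  refine h.eq_zero _ fun i' => ?_
  by_cases hi : i' = i
  · rw [hi, ha]
  · simp [h.map_ne _ _ _ hi]

/-- Projecting to one branch isolates its summand: the ideals generated by distinct pairs form a
direct sum. -/
theorem sum_eq_zero_iff (h : IsLineBouquet z π) {γ : Type} [Fintype γ] {j : γ → ι}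
    (hj : Function.Injective j) (a : γ → Fin 2 → R) :
    ∑ d, ∑ k, a d k * z (j d) k = 0 ↔ ∀ d, ∑ k, a d k * z (j d) k = 0 := by
  refine ⟨fun h0 c => h.sum_branch_eq_zero ?_, fun h0 => Finset.sum_eq_zero fun d _ => h0 d⟩
  rw [← h.map_sum_eq hj, h0, map_zero]

theorem mul_eq_zero (h : IsLineBouquet z π) {i : ι} {r : R} (hr : π i r = 0) (k : Fin 2) :
    r * z i k = 0 := by
  refine h.eq_zero _ fun i' => ?_
  by_cases hi : i' = i
  · rw [hi, map_mul, hr, zero_mul]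
  · rw [map_mul, h.map_ne _ _ _ hi, mul_zero]

theorem map_surjective (h : IsLineBouquet z π) (i : ι) : Function.Surjective (π i) := by
  intro p
  have : (π i).comp (aeval (z i)) = AlgHom.id K _ := by
    ext k
    simp [h.map_same]
  exact ⟨aeval (z i) p, congrArg (fun f => f p) this⟩

/-- An element killed by `π i` has no constant term, and its component in the ideal of pair `i` is
zero because `π i` detects it. -/
theorem mem_outsideIdeal_iff [Fintype ι] (h : IsLineBouquet z π) {i : ι} {r : R} :
    r ∈ outsideIdeal z (some i) ↔ π i r = 0 := by
  classical
  constructor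
  · rw [mem_outsideIdeal]
    rintro ⟨a, rfl⟩
    exact h.map_sum_eq_zero (fun c e => c.2 (congrArg some e.symm)) a
  · intro hr
    obtain ⟨c, hr'⟩ := h.exists_sub_mem r
    obtain ⟨a, ha⟩ := mem_outsideIdeal.1 hr'
    have h1 := h.map_sum_eq Subtype.val_injective a ⟨i, Option.some_ne_none i⟩
    rw [ha] at h1
    have hc : c = 0 := by
      simpa [h.map_same, hr] using congrArg (constantCoeff (σ := Fin 2) (R := K)) h1
    rw [hc, map_zero, sub_zero] at ha h1
    rw [hr] at h1
    rw [← ha]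
    refine Ideal.sum_mem _ fun j _ => ?_
    by_cases hj : j = ⟨i, Option.some_ne_none i⟩
    · rw [hj, h.sum_branch_eq_zero h1.symm]
      exact Ideal.zero_mem _
    · exact Ideal.sum_mem _ fun k _ => Ideal.mul_mem_left _ _ <|
        Ideal.subset_span ⟨⟨⟨j, fun e => hj (Subtype.ext (Option.some.inj e))⟩, k⟩, rfl⟩

/-- The relations on the two generators of a branch are the Koszul relation and those with
coefficients vanishing on the branch. -/
theorem sum_branch_eq_zero_iff (h : IsLineBouquet z π) {i : ι} {b : Fin 2 → R} :
    ∑ k, b k * z i k = 0 ↔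
      ∃ r : R, ∀ k, π i (b k - r * (![z i 1, - z i 0] : Fin 2 → R) k) = 0 := by
  constructor
  · intro hb
    have h1 : π i (b 0) * X 0 + π i (b 1) * X 1 = 0 := by
      simpa [h.map_same] using congrArg (π i) hb
    have hX : (X 1 : MvPolynomial (Fin 2) K) ≠ 0 := X_ne_zero _
    have h2 : (X 1 : MvPolynomial (Fin 2) K) ∣ π i (b 0) * X 0 :=
      ⟨-π i (b 1), by linear_combination h1⟩
    obtain ⟨q, hq⟩ : (X 1 : MvPolynomial (Fin 2) K) ∣ π i (b 0) :=
      -- Over two variables all relations are Koszul; the quotient by `X 1`, lifted to `R`, gives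
      -- the Koszul coefficient.
      ((X_prime (R := K) (i := (1 : Fin 2))).dvd_or_dvd h2).resolve_right (by simp [X_dvd_X])
    obtain ⟨r, rfl⟩ := h.map_surjective i q
    refine ⟨r, Fin.forall_fin_two.2 ⟨?_, ?_⟩⟩
    · simp [h.map_same, hq, mul_comm]
    · have : X 1 * (π i (b 1) + π i r * X 0) = 0 := by
        rw [hq] at h1
        linear_combination h1
      simpa [h.map_same, hX] using this
  · rintro ⟨r, hr⟩
    have h0 := h.mul_eq_zero (hr 0) 0
    have h1 := h.mul_eq_zero (hr 1) 1
    simp only [Matrix.cons_val_zero, Matrix.cons_val_one] at h0 h1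
    rw [Fin.sum_univ_two]
    linear_combination h0 + h1

open BouquetSyzygy in
theorem isKoszul [Fintype ι] (h : IsLineBouquet z π) (𝒜 : ℕ → Submodule K R) (h0 : (1 : R) ∈ 𝒜 0)
    (hz : ∀ i k, z i k ∈ 𝒜 1) (hpos : positiveIdeal 𝒜 = outsideIdeal z none) : IsKoszul 𝒜 := by
  classical
  refine isKoszul_of_split_syzygies 𝒜 h0 rank (BouquetSyzygy.submodule z) (outside none) rfl ?_ ?_
  · intro a
    rw [mem_outside, ← hpos]
    exact (Fin.forall_fin_one (p := fun k => a k ∈ positiveIdeal 𝒜)).symm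
  rintro (o | i)
  · let _ : DecidableEq {j // some j ≠ o} := fun a b => Classical.propDecidable (a = b)
    let M : Matrix (Fin 1) (Σ c : {j // some j ≠ o}, Fin (branch c.1).rank) R :=
      .of fun _ l => z l.1 l.2
    have hM : ∀ a x, M.mulVecLin a x = ∑ j, ∑ k : Fin 2, a ⟨j, k⟩ * z j.1 k := by
      intro a x
      simp only [Matrix.mulVecLin_apply, Matrix.mulVec, dotProduct, M, Matrix.of_apply]
      rw [Fintype.sum_sigma]
      simp only [mul_comm]
    refine ⟨{j // some j ≠ o}, inferInstance, fun c => branch c.1, M.mulVecLin, ?_, ?_, ?_⟩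
    · intro l k
      rw [Matrix.mulVecLin_apply, Matrix.mulVec_single_one]
      exact hz _ _
    · ext b
      rw [mem_outside, mem_outsideIdeal]
      constructor
      · rintro ⟨a, rfl⟩
        exact ⟨fun j k => a ⟨j, k⟩, (hM a 0).symm⟩
      · rintro ⟨a, ha⟩
        refine ⟨fun l => a l.1 l.2, funext fun x => ?_⟩
        rw [hM, ha, Subsingleton.elim (α := Fin 1) x 0]
    · intro a
      have : M.mulVecLin a = 0 ↔ ∑ j : {j // some j ≠ o}, ∑ k : Fin 2, a ⟨j, k⟩ * z j.1 k = 0 :=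
        ⟨fun e => by rw [← hM a 0, e]; rfl, fun e => funext fun x => by rw [hM, e]; rfl⟩
      rw [this]
      exact h.sum_eq_zero_iff Subtype.val_injective fun j k => a ⟨j, k⟩
  · let J := {j // some j ≠ some i}
    let _ : DecidableEq (Unit ⊕ (J × Fin 2)) := fun a b => Classical.propDecidable (a = b)
    let t : Unit ⊕ (J × Fin 2) → BouquetSyzygy ι :=
      Sum.elim (fun _ => outside (some i)) fun p => branch p.1.1
    -- One column is the Koszul relation; the others put each generator of the other pairs in either
    -- coordinate.
    let M : Matrix (Fin 2) (Σ c, Fin (t c).rank) R := .of fun k l =>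
      match l with
      | ⟨.inl _, _⟩ => (![z i 1, - z i 0] : Fin 2 → R) k
      | ⟨.inr p, l⟩ => if k = p.2 then z p.1.1 l else 0
    have hM : ∀ a k, M.mulVecLin a k = a ⟨.inl (), (0 : Fin 1)⟩ * (![z i 1, - z i 0] : Fin 2 → R) k +
        ∑ j : J, ∑ l : Fin 2, a ⟨.inr (j, k), l⟩ * z j.1 l := by
      intro a k
      simp only [Matrix.mulVecLin_apply, Matrix.mulVec, dotProduct, M, Matrix.of_apply]
      rw [Fintype.sum_sigma, Fintype.sum_sum_type, Fintype.sum_prod_type]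
      congr 1
      · simp only [Finset.univ_unique, Finset.sum_singleton]
        refine (Fin.sum_univ_one (fun _ : Fin 1 => _)).trans ?_
        exact mul_comm _ _
      · refine Finset.sum_congr rfl fun j _ => ?_
        rw [Finset.sum_eq_single k]
        · refine Finset.sum_congr rfl fun l _ => ?_
          simp [mul_comm]
        · intro k' _ hk
          refine Finset.sum_eq_zero fun l _ => ?_
          simp [hk.symm]
        · simp
    have hker : ∀ (a : J → Fin 2 → R), π i (∑ j : J, ∑ l, a j l * z j.1 l) = 0 := fun a =>
      h.map_sum_eq_zero (fun c e => c.2 (congrArg some e.symm)) a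
    refine ⟨_, inferInstance, t, M.mulVecLin, ?_, ?_, ?_⟩
    · rintro ⟨_ | p, l⟩ k
      · rw [Matrix.mulVecLin_apply, Matrix.mulVec_single_one]
        revert k
        exact Fin.forall_fin_two.2 ⟨hz i 1, (𝒜 1).neg_mem (hz i 0)⟩
      · rw [Matrix.mulVecLin_apply, Matrix.mulVec_single_one]
        change (if k = p.2 then z p.1.1 l else 0) ∈ 𝒜 1
        split_ifs
        · exact hz _ _
        · exact (𝒜 1).zero_mem
    · ext b
      rw [mem_branch, h.sum_branch_eq_zero_iff]
      constructor
      · rintro ⟨a, rfl⟩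
        refine ⟨a ⟨.inl (), (0 : Fin 1)⟩, fun k => ?_⟩
        rw [hM, add_sub_cancel_left]
        exact hker fun j l => a ⟨.inr (j, k), l⟩
      · rintro ⟨r, hr⟩
        simp only [← h.mem_outsideIdeal_iff, mem_outsideIdeal] at hr
        choose a ha using hr
        refine ⟨fun l => match l with
          | ⟨.inl _, _⟩ => r
          | ⟨.inr p, l⟩ => a p.2 p.1 l, funext fun k => ?_⟩
        rw [hM]
        exact (congrArg _ (ha k)).trans (add_sub_cancel _ _)
    · have hzero : ∀ (a : (Σ c, Fin (t c).rank) → R), π i (a ⟨.inl (), (0 : Fin 1)⟩) = 0 →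
          ∀ k, a ⟨.inl (), (0 : Fin 1)⟩ * (![z i 1, - z i 0] : Fin 2 → R) k = 0 := by
        intro a h1
        rw [Fin.forall_fin_two]
        exact ⟨h.mul_eq_zero h1 1, (mul_neg _ _).trans (neg_eq_zero.2 (h.mul_eq_zero h1 0))⟩
      intro a
      -- Under `π i` the first coordinate becomes the Koszul coefficient times `X 1`, so that
      -- coefficient vanishes on the branch. By `hzero` the Koszul term then drops out, and the two
      -- coordinates decouple.
      have hsplit : M.mulVecLin a = 0 ↔ π i (a ⟨.inl (), (0 : Fin 1)⟩) = 0 ∧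
          ∀ k, ∑ j : J, ∑ l : Fin 2, a ⟨.inr (j, k), l⟩ * z j.1 l = 0 := by
        constructor
        · intro ha
          have h1 : π i (a ⟨.inl (), (0 : Fin 1)⟩) = 0 := by
            have := congrArg (π i) ((hM a 0).symm.trans (congrFun ha 0))
            rw [map_add, hker fun j l => a ⟨.inr (j, 0), l⟩] at this
            simpa [h.map_same, X_ne_zero] using this
          refine ⟨h1, fun k => ?_⟩
          have := (hM a k).symm.trans (congrFun ha k)
          exact (add_eq_right.2 (hzero a h1 k)).symm.trans this
        · rintro ⟨h1, h2⟩
          funext k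
          rw [hM, h2, add_zero]
          exact hzero a h1 k
      rw [hsplit]
      constructor
      · rintro ⟨h1, h2⟩ (_ | ⟨j, k⟩)
        · exact h.mem_outsideIdeal_iff.2 h1
        · exact (h.sum_eq_zero_iff Subtype.val_injective fun j l => a ⟨.inr (j, k), l⟩).1 (h2 k) j
      · intro ha
        refine ⟨h.mem_outsideIdeal_iff.1 (ha (.inl ())), fun k => ?_⟩
        exact Finset.sum_eq_zero fun j _ => ha (.inr (j, k))

end IsLineBouquet

end Bouquet

/-! ### Polynomials on lines and changes of coordinates -/

section LinePolynomials

/-- Restriction of polynomials to the plane spanned by `w 0` and `w 1`, in the corresponding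
coordinates. -/
noncomputable def restrictToPlane {n : ℕ} (w : Fin 2 → Fin (n + 1) → ℂ) :
    MvPolynomial (Fin (n + 1)) ℂ →ₐ[ℂ] MvPolynomial (Fin 2) ℂ :=
  aeval fun j => ∑ k, C (w k j) * X k

theorem eval_restrictToPlane {n : ℕ} (w : Fin 2 → Fin (n + 1) → ℂ) (u : Fin 2 → ℂ)
    (f : MvPolynomial (Fin (n + 1)) ℂ) :
    eval u (restrictToPlane w f) = eval (∑ k, u k • w k) f := by
  have : ((aeval u : MvPolynomial (Fin 2) ℂ →ₐ[ℂ] ℂ).comp (restrictToPlane w)) =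
      aeval (∑ k, u k • w k) := by
    ext j
    simp [restrictToPlane, mul_comm]
  exact congrArg (fun g => g f) this

theorem mem_linesIdeal_iff {n m : ℕ} {L : Fin m → ProjLine n}
    {w : Fin m → Fin 2 → Fin (n + 1) → ℂ}
    (hw : ∀ i, Submodule.span ℂ (Set.range (w i)) = (L i).space)
    {f : MvPolynomial (Fin (n + 1)) ℂ} :
    f ∈ linesIdeal L ↔ ∀ i, restrictToPlane (w i) f = 0 := by
  have hli : ∀ i, LinearIndependent ℂ (w i) := fun i => by
    rw [linearIndependent_iff_card_eq_finrank_span, Set.finrank, hw, (L i).finrank_eq,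
      Fintype.card_fin]
  have hmem : f ∈ linesIdeal L ↔ ∀ i, ∀ v ∈ (L i).space, v ≠ 0 → eval v f = 0 := by
    rw [linesIdeal, definingIdeal, mem_vanishingIdeal_iff]
    simp only [Set.mem_ofPred_eq, Set.mem_iUnion, ProjLine.points, Projectivization.submodule_mk,
      Submodule.span_singleton_le_iff_mem]
    constructor
    · intro h i v hv h0
      exact h v ⟨h0, i, hv⟩
    · rintro h v ⟨h0, i, hv⟩
      exact h i v hv h0
  rw [hmem]
  refine forall_congr' fun i => ?_
  constructor
  · intro h
    -- The hypothesis says nothing at the zero vector. The factor `X 0` takes care of it and is then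
    -- cancelled.
    have : X 0 * restrictToPlane (w i) f = 0 := by
      refine MvPolynomial.funext fun u => ?_
      rw [map_mul, eval_X, map_zero, mul_eq_zero, or_iff_not_imp_left]
      intro hu
      rw [eval_restrictToPlane]
      refine h _ ?_ fun h0 => hu (Fintype.linearIndependent_iff.1 (hli i) u h0 0)
      rw [← hw]
      exact Submodule.sum_mem _ fun k _ =>
        Submodule.smul_mem _ _ (Submodule.subset_span ⟨k, rfl⟩)
    exact (mul_eq_zero.1 this).resolve_left (X_ne_zero _)
  · intro h v hv _
    rw [← hw, Submodule.mem_span_range_iff_exists_fun] at hv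
    obtain ⟨u, rfl⟩ := hv
    rw [← eval_restrictToPlane, h, map_zero]

/-- Lines in general linear position are coordinate lines in suitable coordinates. -/
theorem InGeneralLinearPosition.exists_coordinates {n m : ℕ} (hmn : 2 * m ≤ n + 1)
    {L : Fin m → ProjLine n} (hL : InGeneralLinearPosition L) :
    ∃ (e : Fin m × Fin 2 → Fin (n + 1)) (A : GL (Fin (n + 1)) ℂ), Function.Injective e ∧
      ∀ i, Submodule.span ℂ (Set.range fun k => A.val.col (e (i, k))) = (L i).space := by
  let b := fun i => Module.finBasisOfFinrankEq ℂ (L i).space (L i).finrank_eq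
  let w : Fin m × Fin 2 → Fin (n + 1) → ℂ := fun p => b p.1 p.2
  have hw : ∀ i, Submodule.span ℂ (Set.range fun k => w (i, k)) = (L i).space := by
    intro i
    have := congrArg (Submodule.map (L i).space.subtype) (b i).span_eq
    rw [Submodule.map_span, ← Set.range_comp, Submodule.map_top, Submodule.range_subtype] at this
    exact this
  -- General position is used for the whole family only: `min (2 * m) (n + 1)` equals `2 * m`, the
  -- number of vectors.
  have hli : LinearIndependent ℂ w := by
    have hspan : Submodule.span ℂ (Set.range w) = ⨆ i ∈ Finset.univ, (L i).space := by
      simp only [← hw, Finset.mem_univ, iSup_pos, ← Submodule.span_iUnion]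
      congr 1
      ext v
      simp
    rw [linearIndependent_iff_card_eq_finrank_span, Set.finrank, hspan, hL Finset.univ]
    simp
    omega
  let B := Module.Basis.sumExtend hli
  have hB : ∀ p, B (.inl p) = w p := by
    intro p
    simp only [B, Module.Basis.sumExtend, Module.Basis.reindex_apply, Module.Basis.coe_extend]
    rfl
  have := Module.Finite.finite_basis B
  let := Fintype.ofFinite (Fin m × Fin 2 ⊕ Module.Basis.sumExtendIndex hli)
  let e' : (Fin m × Fin 2 ⊕ Module.Basis.sumExtendIndex hli) ≃ Fin (n + 1) :=
    Fintype.equivFinOfCardEq (by rw [← Module.finrank_eq_card_basis B]; simp)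
  let A₀ : Matrix (Fin (n + 1)) (Fin (n + 1)) ℂ := .of fun r c => B.reindex e' c r
  have hA₀ : IsUnit A₀ := Matrix.linearIndependent_cols_iff_isUnit.1 (B.reindex e').linearIndependent
  refine ⟨fun p => e' (.inl p), hA₀.unit, e'.injective.comp Sum.inl_injective, fun i => ?_⟩
  rw [← hw]
  congr 2
  funext k
  rw [← hB]
  funext r
  simp [A₀, Matrix.col]

theorem linearSubst_linearSubst {n : ℕ} (A B : Matrix (Fin (n + 1)) (Fin (n + 1)) ℂ)
    (f : MvPolynomial (Fin (n + 1)) ℂ) :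
    linearSubst A (linearSubst B f) = linearSubst (B * A) f := by
  have : (linearSubst A).comp (linearSubst B) = linearSubst (B * A) := by
    ext1 i
    simp only [AlgHom.comp_apply, linearSubst, aeval_X, map_sum, map_mul, algHom_C,
      MvPolynomial.algebraMap_eq, Matrix.mul_apply, Finset.sum_mul, Finset.mul_sum, mul_assoc]
    exact Finset.sum_comm
  exact congrArg (fun g => g f) this

theorem linearSubst_one {n : ℕ} (f : MvPolynomial (Fin (n + 1)) ℂ) : linearSubst 1 f = f := by
  have : linearSubst (1 : Matrix (Fin (n + 1)) (Fin (n + 1)) ℂ) = AlgHom.id ℂ _ := by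
    ext1 i
    simp [linearSubst, Matrix.one_apply]
  exact congrArg (fun g => g f) this

/-- As `A⁻¹ * A = 1`, restricting to a plane spanned by columns of `A` becomes setting the remaining
new variables to zero. -/
theorem restrictToPlane_linearSubst_inv {n : ℕ} (A : GL (Fin (n + 1)) ℂ)
    {e : Fin 2 → Fin (n + 1)} (he : Function.Injective e) (f : MvPolynomial (Fin (n + 1)) ℂ) :
    restrictToPlane (fun k => A.val.col (e k)) (linearSubst A⁻¹.val f) = killCompl he f := by
  have : (restrictToPlane (fun k => A.val.col (e k))).comp (linearSubst A⁻¹.val) =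
      killCompl he := by
    ext1 i
    have h1 : ∀ k, ∑ j, A⁻¹.val i j * A.val j (e k) = if i = e k then 1 else 0 := by
      intro k
      rw [← Matrix.mul_apply, ← Units.val_mul, inv_mul_cancel, Units.val_one, Matrix.one_apply]
    have h2 : restrictToPlane (fun k => A.val.col (e k)) (linearSubst A⁻¹.val (X i)) =
        ∑ k, C (∑ j, A⁻¹.val i j * A.val j (e k)) * X k := by
      simp only [linearSubst, restrictToPlane, aeval_X, map_sum, map_mul, algHom_C,
        MvPolynomial.algebraMap_eq, Finset.sum_mul, Finset.mul_sum, Matrix.col, mul_assoc,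
        Matrix.transpose_apply]
      exact Finset.sum_comm
    rw [AlgHom.comp_apply, h2]
    simp only [h1]
    by_cases hi : i ∈ Set.range e
    · obtain ⟨k, rfl⟩ := hi
      rw [← rename_X (R := ℂ), killCompl_rename_app]
      simp [he.eq_iff]
    · rw [killCompl, aeval_X, dif_neg hi]
      refine Finset.sum_eq_zero fun k _ => ?_
      rw [if_neg fun h => hi ⟨k, h.symm⟩, C_0, zero_mul]
  exact congrArg (fun g => g f) this

end LinePolynomials

/-! ### Monomial ideals of coordinate lines -/

section CoordinateLines

theorem killCompl_eq_zero_iff {R σ τ : Type*} [CommSemiring R] {e : σ → τ}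
    (he : Function.Injective e) {f : MvPolynomial τ R} :
    killCompl he f = 0 ↔ ∀ d ∈ f.support, ¬ (d.support : Set τ) ⊆ Set.range e := by
  classical
  constructor
  · intro h d hd hsub
    rw [mem_support_iff] at hd
    rw [← Finsupp.mapDomain_comapDomain e he d hsub, ← coeff_killCompl he, h, coeff_zero] at hd
    exact hd rfl
  · intro h
    ext s
    rw [coeff_killCompl, coeff_zero]
    by_contra hs
    refine h _ (mem_support_iff.2 hs) fun x hx => ?_
    obtain ⟨y, -, rfl⟩ := Finset.mem_image.1 (Finsupp.mapDomain_support hx)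
    exact ⟨y, rfl⟩

/-- The exponents of the monomials vanishing on the coordinate subspaces given by `e`. -/
def offExponents {ι κ τ : Type*} (e : ι × κ → τ) : Set (τ →₀ ℕ) :=
  {d | ∀ i, ¬ (d.support : Set τ) ⊆ Set.range fun k => e (i, k)}

/-- Such an exponent dominates either one variable in no block or two variables not in a common
block; these are already in the set, so minimality forces equality. -/
theorem degree_le_two_of_minimal_offExponents {ι κ τ : Type*} [Nonempty ι] {e : ι × κ → τ}
    (he : Function.Injective e) {d : τ →₀ ℕ} (hd : Minimal (· ∈ offExponents e) d) :
    d.degree ≤ 2 := by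
  classical
  have hout : ∀ i, ∃ a ∈ d.support, ∀ k, e (i, k) ≠ a := by
    intro i
    simpa [Set.not_subset] using hd.prop i
  obtain ⟨a, ha, -⟩ := hout (Classical.arbitrary ι)
  by_cases h : ∃ i k, e (i, k) = a
  · obtain ⟨i, k, hik⟩ := h
    obtain ⟨b, hb, hib⟩ := hout i
    have hab : a ≠ b := fun h => hib k (hik.trans h)
    have hle : Finsupp.single a 1 + Finsupp.single b 1 ≤ d := by
      intro x
      rw [Finsupp.mem_support_iff] at ha hb
      simp only [Finsupp.add_apply, Finsupp.single_apply]
      split_ifs with h1 h2 h2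
      · exact absurd (h1.trans h2.symm) hab
      · subst h1; omega
      · subst h2; omega
      · omega
    have hmem : Finsupp.single a 1 + Finsupp.single b 1 ∈ offExponents e := by
      intro i' hsub
      obtain ⟨k', hk'⟩ := @hsub a (by simp)
      obtain ⟨k'', hk''⟩ := @hsub b (by simp)
      have : i' = i := congrArg Prod.fst (he (hk'.trans hik.symm))
      subst this
      exact hib k'' hk''
    rw [← hd.eq_of_le hmem hle]
    simp
  · have hle : Finsupp.single a 1 ≤ d := by
      rw [Finsupp.single_le_iff]
      rw [Finsupp.mem_support_iff] at ha
      omega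
    have hmem : Finsupp.single a 1 ∈ offExponents e := by
      intro i hsub
      obtain ⟨k, hk⟩ := @hsub a (by simp)
      exact h ⟨i, k, hk⟩
    rw [← hd.eq_of_le hmem hle]
    simp

/-- The monomials with minimal exponents in `U` minimally generate the ideal of all polynomials
with exponents in `U`. -/
theorem minimal_span_monomial {R τ : Type*} [CommRing R] [Nontrivial R] [Finite τ]
    (U : Set (τ →₀ ℕ)) (hU : ∀ d ∈ U, ∀ d', d ≤ d' → d' ∈ U) (I : Ideal (MvPolynomial τ R))
    (hI : ∀ f, f ∈ I ↔ ∀ d ∈ f.support, d ∈ U) :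
    Minimal (fun H : Set (MvPolynomial τ R) => Ideal.span H = I)
      ((fun d => monomial d 1) '' {d | Minimal (· ∈ U) d}) := by
  constructor
  · ext f
    rw [mem_ideal_span_monomial_image, hI]
    refine forall₂_congr fun d _ => ⟨?_, fun hd => ?_⟩
    · rintro ⟨d', hd', hle⟩
      exact hU _ hd'.prop _ hle
    · obtain ⟨d', hle, hd'⟩ := exists_minimal_le_of_wellFoundedLT (· ∈ U) d hd
      exact ⟨d', hd', hle⟩
  · rintro H hH hHG _ ⟨d, hd, rfl⟩
    obtain ⟨s, hs, rfl⟩ := Set.subset_image_iff.1 hHG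
    have h1 : monomial d (1 : R) ∈ I := by
      rw [hI]
      intro d' hd'
      rw [Finset.mem_singleton.1 (support_monomial_subset hd')]
      exact hd.prop
    rw [← hH, mem_ideal_span_monomial_image] at h1
    -- A monomial of the smaller generating set must divide this one; minimality of `d` makes them
    -- equal.
    obtain ⟨d', hd', hle⟩ := h1 d (by classical simp [coeff_monomial])
    exact ⟨d', hd', by rw [hd.eq_of_le (hs hd').prop hle]⟩

end CoordinateLines

/-! ### The coordinate ring as a bouquet of lines -/

section LinesRing

variable {n m : ℕ} {L : Fin m → ProjLine n} {e : Fin m × Fin 2 → Fin (n + 1)}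
  {A : GL (Fin (n + 1)) ℂ}

theorem linearSubst_inv_mem_linesIdeal_iff (he : Function.Injective e)
    (hA : ∀ i, Submodule.span ℂ (Set.range fun k => A.val.col (e (i, k))) = (L i).space)
    {f : MvPolynomial (Fin (n + 1)) ℂ} :
    linearSubst A⁻¹.val f ∈ linesIdeal L ↔ ∀ d ∈ f.support, d ∈ offExponents e := by
  have he' : ∀ i, Function.Injective fun k => e (i, k) :=
    fun i => he.comp (Prod.mk_right_injective i)
  rw [mem_linesIdeal_iff hA]
  simp only [restrictToPlane_linearSubst_inv A (he' _), killCompl_eq_zero_iff]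
  exact ⟨fun h d hd i => h i d hd, fun h i d hd => h d hd i⟩

theorem linearSubst_linearSubst_inv (A : GL (Fin (n + 1)) ℂ)
    (f : MvPolynomial (Fin (n + 1)) ℂ) : linearSubst A.val (linearSubst A⁻¹.val f) = f := by
  rw [linearSubst_linearSubst, ← Units.val_mul, inv_mul_cancel, Units.val_one, linearSubst_one]

theorem linearSubst_inv_linearSubst (A : GL (Fin (n + 1)) ℂ)
    (f : MvPolynomial (Fin (n + 1)) ℂ) : linearSubst A⁻¹.val (linearSubst A.val f) = f := by
  rw [linearSubst_linearSubst, ← Units.val_mul, mul_inv_cancel, Units.val_one, linearSubst_one]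

theorem mem_map_linearSubst_iff (I : Ideal (MvPolynomial (Fin (n + 1)) ℂ))
    (A : GL (Fin (n + 1)) ℂ) {f : MvPolynomial (Fin (n + 1)) ℂ} :
    f ∈ I.map (linearSubst A.val) ↔ linearSubst A⁻¹.val f ∈ I := by
  rw [Ideal.mem_map_iff_of_surjective _ fun g => ⟨_, linearSubst_linearSubst_inv A g⟩]
  constructor
  · rintro ⟨g, hg, rfl⟩
    rwa [linearSubst_inv_linearSubst]
  · exact fun h => ⟨_, h, linearSubst_linearSubst_inv A f⟩

theorem isKoszul_linesRing (he : Function.Injective e)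
    (hA : ∀ i, Submodule.span ℂ (Set.range fun k => A.val.col (e (i, k))) = (L i).space) :
    IsKoszul (R := LinesRing L) (quotientGrading (linesIdeal L)) := by
  classical
  have he' : ∀ i, Function.Injective fun k => e (i, k) :=
    fun i => he.comp (Prod.mk_right_injective i)
  let q : MvPolynomial (Fin (n + 1)) ℂ →ₐ[ℂ] LinesRing L := Ideal.Quotient.mkₐ ℂ (linesIdeal L)
  have hq : Function.Surjective q := Ideal.Quotient.mk_surjective
  let z : Fin m → Fin 2 → LinesRing L := fun i k => q (linearSubst A⁻¹.val (X (e (i, k))))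
  let π : Fin m → LinesRing L →ₐ[ℂ] MvPolynomial (Fin 2) ℂ := fun i =>
    Ideal.Quotient.liftₐ (linesIdeal L) (restrictToPlane fun k => A.val.col (e (i, k)))
      fun f hf => (mem_linesIdeal_iff hA).1 hf i
  have hπ : ∀ i f, π i (q f) = restrictToPlane (fun k => A.val.col (e (i, k))) f :=
    fun _ _ => rfl
  have hX' : ∀ j, q (linearSubst A⁻¹.val (X j)) ∈ outsideIdeal z none := by
    intro j
    by_cases hj : ∃ p, e p = j
    · obtain ⟨⟨i, k⟩, rfl⟩ := hj
      exact Ideal.subset_span ⟨⟨⟨i, Option.some_ne_none i⟩, k⟩, rfl⟩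
    · have : linearSubst A⁻¹.val (X j) ∈ linesIdeal L := by
        rw [linearSubst_inv_mem_linesIdeal_iff he hA]
        intro d hd i hsub
        rw [support_X, Finset.mem_singleton] at hd
        subst hd
        obtain ⟨k, hk⟩ := @hsub j (by simp)
        exact hj ⟨_, hk⟩
      have : q (linearSubst A⁻¹.val (X j)) = 0 := Ideal.Quotient.eq_zero_iff_mem.2 this
      rw [this]
      exact Ideal.zero_mem _
  -- The old variables are linear combinations of the new ones, so they lie in the same ideal.
  have hX : ∀ j, q (X j) ∈ outsideIdeal z none := by
    intro j
    have : X j = ∑ l, C (A.val j l) * linearSubst A⁻¹.val (X l) := by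
      have h1 : linearSubst A.val (X j) = ∑ l, C (A.val j l) * X l := by rw [linearSubst, aeval_X]
      rw [← linearSubst_inv_linearSubst A (X j), h1, map_sum]
      simp only [map_mul, algHom_C, MvPolynomial.algebraMap_eq]
    rw [this, map_sum]
    refine Ideal.sum_mem _ fun l _ => ?_
    rw [map_mul]
    exact Ideal.mul_mem_left _ _ (hX' l)
  have hq_sub : ∀ f, q f - algebraMap ℂ _ (constantCoeff f) ∈ outsideIdeal z none := by
    intro f
    induction f using MvPolynomial.induction_on with
    | C a =>
      rw [algHom_C, constantCoeff_C, sub_self]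
      exact Ideal.zero_mem _
    | add f g hf hg =>
      rw [map_add, map_add, map_add, add_sub_add_comm]
      exact Ideal.add_mem _ hf hg
    | mul_X f j _ =>
      rw [map_mul, map_mul, constantCoeff_X, mul_zero, map_zero, sub_zero]
      exact Ideal.mul_mem_left _ _ (hX j)
  have hz : ∀ i k, z i k ∈ quotientGrading (linesIdeal L) 1 := by
    intro i k
    refine ⟨_, ?_, rfl⟩
    rw [SetLike.mem_coe, mem_homogeneousSubmodule, linearSubst, aeval_X]
    exact IsHomogeneous.sum _ _ _ fun j _ => isHomogeneous_C_mul_X _ _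
  have hbouquet : IsLineBouquet z π :=
    { eq_zero := by
        intro r hr
        obtain ⟨f, rfl⟩ := hq r
        exact Ideal.Quotient.eq_zero_iff_mem.2 ((mem_linesIdeal_iff hA).2 hr)
      map_same := by
        intro i k
        rw [hπ, restrictToPlane_linearSubst_inv A (he' i), ← rename_X (R := ℂ) (fun k => e (i, k)),
          killCompl_rename_app]
      map_ne := by
        intro i j k hij
        rw [hπ, restrictToPlane_linearSubst_inv A (he' i), killCompl_eq_zero_iff]
        intro d hd hsub
        rw [support_X, Finset.mem_singleton] at hd
        subst hd
        obtain ⟨l, hl⟩ := @hsub (e (j, k)) (by simp)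
        exact hij (congrArg Prod.fst (he hl))
      exists_sub_mem := by
        intro r
        obtain ⟨f, rfl⟩ := hq r
        exact ⟨_, hq_sub f⟩ }
  refine hbouquet.isKoszul _ ⟨1, isHomogeneous_one _ _, map_one q⟩ hz (le_antisymm ?_ ?_)
  · rw [positiveIdeal, Ideal.span_le]
    rintro _ ⟨i, hi, f, hf, rfl⟩
    have h0 : constantCoeff f = 0 :=
      (show f.IsHomogeneous i from hf).coeff_eq_zero (by simpa using hi.ne)
    have := hq_sub f
    rwa [h0, map_zero, sub_zero] at this
  · rw [outsideIdeal, Ideal.span_le]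
    rintro _ ⟨p, rfl⟩
    exact Ideal.subset_span ⟨1, one_pos, hz _ _⟩

end LinesRing

theorem proposition4p1 (n m : ℕ) (hn : 3 ≤ n) (hm : 1 ≤ m) (hmn : 2 * m ≤ n + 1)
    (L : Fin m → ProjLine n) (hL : InGeneralLinearPosition L) :
    (∃ A : GL (Fin (n + 1)) ℂ, ∃ G : Set (MvPolynomial (Fin (n + 1)) ℂ),
      (∀ g ∈ G, ∃ e : Fin (n + 1) →₀ ℕ, e.degree ≤ 2 ∧ g = monomial e 1) ∧
      Minimal (fun H : Set (MvPolynomial (Fin (n + 1)) ℂ) =>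
        Ideal.span H = (linesIdeal L).map (linearSubst A.val)) G) ∧
    IsKoszul (R := LinesRing L) (quotientGrading (linesIdeal L)) := by
  obtain ⟨e, A, he, hA⟩ := hL.exists_coordinates hmn
  have : Nonempty (Fin m) := ⟨⟨0, hm⟩⟩
  refine ⟨⟨A, (fun d => monomial d 1) '' {d | Minimal (· ∈ offExponents e) d}, ?_, ?_⟩,
    isKoszul_linesRing he hA⟩
  · rintro _ ⟨d, hd, rfl⟩
    exact ⟨d, degree_le_two_of_minimal_offExponents he hd, rfl⟩
  · refine minimal_span_monomial (offExponents e) (fun d hd d' hle i hsub => hd i ?_) _ fun f => ?_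
    · exact (Finset.coe_subset.2 (Finsupp.support_mono hle)).trans hsub
    · rw [mem_map_linearSubst_iff, linearSubst_inv_mem_linesIdeal_iff he hA]
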